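/- **Proposition ($\Omega_0^{-1}B_0\in\mathcal L^2$ as a pivotal condition).** Let $\mathfrak h=\bigoplus_{[k]\in\mathbb Z/\{-1,1\}}\mathbb C^2$ (an $\ell^2$-space with its natural complex conjugation), where $[k]=\{k,-k\}$. For a bounded operator $X$ let $\bar X f=\overline{X\bar f}$ and $X^{\mathrm t}=\overline{X^*}$ (similarly for densely defined operators), let $\mathcal L^2(\mathfrak h)$ be the space of Hilbert–Schmidt operators, and $\|X\|_2=\sqrt{\operatorname{tr}(X^*X)}$. There are real numbers $\omega_k>0$ ($k\in\mathbb Z$) and $b_k=b_{-k}$ such that the operators $$\Omega_0=\bigoplus_{[k]\in\mathbb Z/\{-1,1\}}\begin{pmatrix}\omega_{-k}&0\\0&\omega_k\end{pmatrix},\qquad B_0=\bigoplus_{[k]\in\mathbb Z/\{-1,1\}}\begin{pmatrix}0&b_k\\b_k&0\end{pmatrix}$$ on $\mathfrak h$ have the following properties. 1. (A1) $\Omega_0=\Omega_0^*\ge 0$. (A2) $B_0=B_0^{\mathrm t}\in\mathcal L^2(\mathfrak h)$ and $B_0\neq 0$. (A3) $\Omega_0$ is invertible on $\operatorname{Ran}B_0$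 and $\Omega_0\ge 4B_0(\Omega_0^{\mathrm t})^{-1}\bar B_0$. (A4) $\Omega_0^{-1/2}B_0\in\mathcal L^2(\mathfrak h)$. 2. $\omega_k^2>4b_k^2$ and $\omega_{-k}^2>4b_k^2$ for all $[k]$, and $\mathbf 1>4B_0(\Omega_0^{\mathrm t})^{-2}\bar B_0$ in the sense of quadratic forms, i.e. $4\|(\Omega_0^{\mathrm t})^{-1}\bar B_0x\|^2<\|x\|^2$ for all $x\ne0$. 3. $\Omega_0^{-1+\varepsilon}B_0\in\mathcal L^2(\mathfrak h)$ for every $\varepsilon>0$. 4. The system $$\partial_t\Omega_t=-16B_t\bar B_t,\qquad \partial_tB_t=-2\left(\Omega_tB_t+B_t\Omega_t^{\mathrm t}\right),$$ with initial value $(\Omega_0,B_0)$ at $t=0$, has exactly one solution $(\Omega_t,B_t)_{t\ge0}$, a solution being a family with $\Omega_t=\Omega_t^*\ge0$, $\Omega_t-\Omega_0\in\mathcal L^2(\mathfrak h)$, $B_t\in\mathcal L^2(\mathfrak h)$ and $t\mapsto B_t$ continuous on $[0,\infty)$ in $\mathcal L^2(\mathfrak h)$, for which the first equation holds for $t\ge0$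 and the second for $t>0$, both in the Hilbert–Schmidt topology. 5. For this solution there are $c>0$ and $T>0$ with $\|B_t\|_2\ge c\,t^{-1}$ for all $t\ge T$. In particular, $t\mapsto\|B_t\|_2$ is not integrable on $[0,\infty)$. -/

import Mathlib

namespace QuadFlow

open Filter Topology

noncomputable section

/-! ### Operators on `ℓ²(ι)` -/

/-- The complex Hilbert space `ℓ²(ι)`, that is, `L²(ι)` for the counting measure. -/
abbrev Hil (ι : Type) : Type := lp (fun _ : ι => ℂ) 2

/-- The pointwise complex conjugation of `ℓ²(ι)`, as an antilinear map. -/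
def conjL (ι : Type) : Hil ι →L⋆[ℂ] Hil ι := (starL ℂ : Hil ι ≃L⋆[ℂ] Hil ι)

theorem conjL_apply {ι : Type} (x : Hil ι) : conjL ι x = star x := rfl

/-- Complex conjugate `X̄ : x ↦ conj (X (conj x))` of a bounded operator. -/
def conjOp {ι : Type} (X : Hil ι →L[ℂ] Hil ι) : Hil ι →L[ℂ] Hil ι :=
  ((conjL ι).comp X).comp (conjL ι)

theorem conjOp_apply {ι : Type} (X : Hil ι →L[ℂ] Hil ι) (x : Hil ι) :
    conjOp X x = star (X (star x)) := rfl

/-- Transpose `Xᵗ`, the complex conjugate of the adjoint of a bounded operator. -/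
def transOp {ι : Type} (X : Hil ι →L[ℂ] Hil ι) : Hil ι →L[ℂ] Hil ι :=
  conjOp (ContinuousLinearMap.adjoint X)

/-- Transposes are characterized by `⟨f | Xᵗ g⟩ = ⟨conj g | X (conj f)⟩`. -/
theorem inner_transOp {ι : Type} (X : Hil ι →L[ℂ] Hil ι) (f g : Hil ι) :
    inner ℂ f (transOp X g) = inner ℂ (star g) (X (star f)) := by
  have key : ∀ u v : Hil ι, inner ℂ u (star v) = inner ℂ v (star u) := by
    intro u v
    simp only [lp.inner_eq_tsum]
    refine tsum_congr fun i => ?_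
    simp [mul_comm]
  rw [transOp, conjOp_apply, key, ContinuousLinearMap.adjoint_inner_left]

/-- Complex conjugate of a possibly unbounded operator. -/
def conjPMap {ι : Type} (A : Hil ι →ₗ.[ℂ] Hil ι) : Hil ι →ₗ.[ℂ] Hil ι where
  domain := A.domain.comap (conjL ι : Hil ι →ₗ⋆[ℂ] Hil ι)
  toFun :=
    { toFun := fun x => star (A ⟨star (x : Hil ι), x.2⟩)
      map_add' := fun x y => by
        rw [← star_add, ← LinearPMap.map_add]
        congr 2
        exact Subtype.ext (star_add (x : Hil ι) (y : Hil ι))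
      map_smul' := fun c x => by
        have h : A ⟨star ((c • x : _) : Hil ι), (c • x).2⟩
            = star c • A ⟨star (x : Hil ι), x.2⟩ := by
          rw [← LinearPMap.map_smul]
          congr 1
          exact Subtype.ext (star_smul c (x : Hil ι))
        rw [h, star_smul, star_star]
        rfl }

/-- Transpose of a possibly unbounded operator, the complex conjugate of its adjoint. -/
def transPMap {ι : Type} (A : Hil ι →ₗ.[ℂ] Hil ι) : Hil ι →ₗ.[ℂ] Hil ι :=
  conjPMap A.adjoint

/-- The multiplication operator `x ↦ (f i * x i)ᵢ` with its maximal domain. -/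
def diagOp {ι : Type} (f : ι → ℝ) : Hil ι →ₗ.[ℂ] Hil ι where
  domain :=
    { carrier := {x | Memℓp (fun i => (f i : ℂ) * x i) 2}
      add_mem' := fun {x y} hx hy => by
        have h := Memℓp.add hx hy
        have e : (fun i => (f i : ℂ) * x i) + (fun i => (f i : ℂ) * y i)
            = fun i => (f i : ℂ) * (x + y : Hil ι) i := by
          funext i
          simp [mul_add]
        change Memℓp (fun i => (f i : ℂ) * (x + y : Hil ι) i) 2
        rw [← e]
        exact h
      zero_mem' := by
        have e : (fun i => (f i : ℂ) * (0 : Hil ι) i) = 0 := by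
          funext i
          simp
        change Memℓp (fun i => (f i : ℂ) * (0 : Hil ι) i) 2
        rw [e]
        exact zero_memℓp
      smul_mem' := fun c x hx => by
        have h := Memℓp.const_smul hx c
        have e : c • (fun i => (f i : ℂ) * x i)
            = fun i => (f i : ℂ) * (c • x : Hil ι) i := by
          funext i
          simp [mul_left_comm]
        change Memℓp (fun i => (f i : ℂ) * (c • x : Hil ι) i) 2
        rw [← e]
        exact h }
  toFun :=
    { toFun := fun x => ⟨fun i => (f i : ℂ) * (x : Hil ι) i, x.2⟩
      map_add' := fun x y => by
        refine lp.ext (funext fun i => ?_)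
        exact mul_add _ _ _
      map_smul' := fun c x => by
        refine lp.ext (funext fun i => ?_)
        simp [mul_left_comm] }

/-- `X` is Hilbert–Schmidt: `tr (X* X) = ∑ᵢ ‖X eᵢ‖² < ∞`, with the canonical basis of `ℓ²(ι)`. -/
def IsHS {ι : Type} [DecidableEq ι] (X : Hil ι →L[ℂ] Hil ι) : Prop :=
  Summable fun i => ‖X (lp.single 2 i (1 : ℂ))‖ ^ 2

/-- The Hilbert–Schmidt norm `‖X‖₂ = √(tr (X* X))` of a Hilbert–Schmidt operator. -/
def hsNorm {ι : Type} [DecidableEq ι] (X : Hil ι →L[ℂ] Hil ι) : ℝ :=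
  Real.sqrt (∑' i, ‖X (lp.single 2 i (1 : ℂ))‖ ^ 2)

/-- `F` tends to `L` along `l` in the Hilbert–Schmidt topology. -/
def HSTendsto {ι : Type} [DecidableEq ι] (F : ℝ → (Hil ι →L[ℂ] Hil ι)) (l : Filter ℝ)
    (L : Hil ι →L[ℂ] Hil ι) : Prop :=
  (∀ᶠ s in l, IsHS (F s - L)) ∧ Tendsto (fun s => hsNorm (F s - L)) l (𝓝 0)

/-- On `[0, ∞)`, the map `F` has at `t` the derivative `D` in the Hilbert–Schmidt topology. -/
def HasHSDeriv {ι : Type} [DecidableEq ι] (F : ℝ → (Hil ι →L[ℂ] Hil ι))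
    (D : Hil ι →L[ℂ] Hil ι) (t : ℝ) : Prop :=
  IsHS D ∧
    HSTendsto (fun s => ((s - t : ℝ) : ℂ)⁻¹ • (F s - F t)) (𝓝[Set.Ici 0 \ {t}] t) D

/-- `A B` is defined on the whole space and is a Hilbert–Schmidt operator. -/
def MulIsHS {ι : Type} [DecidableEq ι] (A : Hil ι →ₗ.[ℂ] Hil ι)
    (B : Hil ι →L[ℂ] Hil ι) : Prop :=
  ∃ C : Hil ι →L[ℂ] Hil ι, IsHS C ∧ ∀ x, ∃ h : B x ∈ A.domain, A ⟨B x, h⟩ = C x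

/-! ### The conditions on the initial data -/

/-- `Ω = Ω* ≥ 0`. -/
def CondA1 {ι : Type} (Ω : Hil ι →ₗ.[ℂ] Hil ι) : Prop :=
  IsSelfAdjoint Ω ∧ ∀ x : Ω.domain, 0 ≤ (inner ℂ (x : Hil ι) (Ω x)).re

/-- `B = Bᵗ` is a non-zero Hilbert–Schmidt operator. -/
def CondA2 {ι : Type} [DecidableEq ι] (B : Hil ι →L[ℂ] Hil ι) : Prop :=
  transOp B = B ∧ IsHS B ∧ B ≠ 0

/-- `Ω` is invertible on `Ran B` and `Ω ≥ 4 B (Ωᵗ)⁻¹ B̄`; here `y = (Ωᵗ)⁻¹ B̄ x`. -/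
def CondA3 {ι : Type} (Ω : Hil ι →ₗ.[ℂ] Hil ι) (B : Hil ι →L[ℂ] Hil ι) : Prop :=
  (∀ z, ∃! y : Ω.domain, Ω y = B z) ∧
    ∀ x : Ω.domain, ∃ y : (transPMap Ω).domain, transPMap Ω y = conjOp B x ∧
      4 * (inner ℂ (x : Hil ι) (B y)).re ≤ (inner ℂ (x : Hil ι) (Ω x)).re

/-- `1 > 4 B (Ωᵗ)⁻² B̄` in the sense of quadratic forms, for `Ω = Ω*` and `B = Bᵗ`:
`4 ‖(Ωᵗ)⁻¹ B̄ x‖² < ‖x‖²` for all `x ≠ 0`; here `y = (Ωᵗ)⁻¹ B̄ x`. -/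
def StrictIneq {ι : Type} (Ω : Hil ι →ₗ.[ℂ] Hil ι) (B : Hil ι →L[ℂ] Hil ι) : Prop :=
  ∀ x : Hil ι, x ≠ 0 → ∃ y : (transPMap Ω).domain, transPMap Ω y = conjOp B x ∧
    4 * ‖(y : Hil ι)‖ ^ 2 < ‖x‖ ^ 2

/-! ### The flow -/

/-- `(Ω_t, B_t)_{t ≥ 0}` solves
`∂ₜ Ω_t = -16 B_t B̄_t`, `∂ₜ B_t = -2 (Ω_t B_t + B_t Ω_tᵗ)` with initial value `(Ω₀, B₀)`:
* the `Ω_t` are self-adjoint and positive, `Δ_t = Ω_t - Ω₀` is Hilbert–Schmidt, and the first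
  equation holds on `[0, ∞)` in the Hilbert–Schmidt topology;
* `t ↦ B_t` is continuous on `[0, ∞)` in the Hilbert–Schmidt topology, and the second equation
  holds for `t > 0` in this topology, its right-hand side being the Hilbert–Schmidt operator
  that agrees with `-2 (Ω_t B_t + B_t Ω_tᵗ)` on the dense domain of `Ω_tᵗ`.
Values at negative times are irrelevant. -/
structure IsFlow {ι : Type} [DecidableEq ι] (Ω₀ : Hil ι →ₗ.[ℂ] Hil ι)
    (B₀ : Hil ι →L[ℂ] Hil ι) (Ω : ℝ → (Hil ι →ₗ.[ℂ] Hil ι))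
    (B : ℝ → (Hil ι →L[ℂ] Hil ι)) : Prop where
  omega_zero : Ω 0 = Ω₀
  b_zero : B 0 = B₀
  omega_pos : ∀ t, 0 ≤ t → CondA1 (Ω t)
  b_hs : ∀ t, 0 ≤ t → IsHS (B t)
  b_cont : ∀ t, 0 ≤ t → HSTendsto B (𝓝[Set.Ici 0] t) (B t)
  omega_deriv : ∃ Δ : ℝ → (Hil ι →L[ℂ] Hil ι), ∀ t, 0 ≤ t →
    IsHS (Δ t) ∧ Ω t = (Δ t : Hil ι →ₗ[ℂ] Hil ι) +ᵥ Ω₀ ∧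
      HasHSDeriv Δ (-(16 : ℂ) • (B t).comp (conjOp (B t))) t
  b_deriv : ∀ t, 0 < t → ∃ D : Hil ι →L[ℂ] Hil ι, HasHSDeriv B D t ∧
    ∀ x : (transPMap (Ω t)).domain, ∃ h : B t x ∈ (Ω t).domain,
      D x = -(2 : ℂ) • (Ω t ⟨B t x, h⟩ + B t (transPMap (Ω t) x))

/-! ### Direct sums of `2 × 2` blocks -/

/-- Index set of `⨁_{[k] ∈ ℤ/{±1}} ℂ²`: the class `[k] = {k, -k}` is given by `|k| ∈ ℕ`, and
`false`, `true` are the two coordinates of its block, belonging to `-|k|` and `|k|`. -/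
abbrev Ix : Type := ℕ × Bool

/-- The integer to which a coordinate belongs. -/
def mode : Ix → ℤ
  | (k, false) => -(k : ℤ)
  | (k, true) => (k : ℤ)

/-- The real power `Ω₀ˢ` of `Ω₀ = ⨁_{[k]} diag (ω₋ₖ, ωₖ)`, for positive `ω`: the diagonal
operator `⨁_{[k]} diag (ω₋ₖˢ, ωₖˢ)`. -/
def blockPow (ω : ℤ → ℝ) (s : ℝ) : Hil Ix →ₗ.[ℂ] Hil Ix :=
  diagOp fun i => ω (mode i) ^ s

/-- The operator `Ω₀ = ⨁_{[k]} diag (ω₋ₖ, ωₖ)`. -/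
def blockOmega (ω : ℤ → ℝ) : Hil Ix →ₗ.[ℂ] Hil Ix :=
  diagOp fun i => ω (mode i)

/-- `B` is the direct sum over `[k]` of the matrices with rows `(0, bₖ)` and `(bₖ, 0)`. -/
def IsBlockB (b : ℕ → ℝ) (B : Hil Ix →L[ℂ] Hil Ix) : Prop :=
  ∀ (x : Hil Ix) (k : ℕ) (s : Bool), B x (k, s) = (b k : ℂ) * x (k, !s)

end

end QuadFlow

/-!
On a pair of modes of scale `λ` the flow is the scalar system `ω' = -16 b²`, `b' = -4 ω b`, whose
invariant `ω² - 4 b² = λ²` leads to the solution `ω = λ coth (4 λ t + 1)`,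
`b = λ / (2 sinh (4 λ t + 1))`. It obeys the scaling `b_λ(t) = λ b₁(λ t)`. With the scales
`λ = 2⁻ᵏ`, the ratios `b / ω` are initially all equal, so that `Ω₀⁻¹⁺ᵋ B₀` is a multiple of
`⨁ 2^(-ε k)`, which is Hilbert–Schmidt if and only if `ε > 0`. On the other hand, for each `t ≥ 1`
some scale satisfies `1 ≤ λ t ≤ 2`, and this block alone contributes a constant times `1 / t` to
`‖B_t‖₂`. For uniqueness, a solution is `Ω₀` plus a Hilbert–Schmidt, hence bounded, perturbation,
and the Hilbert–Schmidt norm dominates the operator norm: since `Ω₀` is bounded here, all solutions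
solve an ordinary differential equation with quadratic, hence locally Lipschitz, right-hand side.
-/

namespace QuadFlow

open Filter Topology

noncomputable section

section SquareSummable

variable {ι : Type}

theorem memℓp_two_iff {f : ι → ℂ} : Memℓp f 2 ↔ Summable fun i => ‖f i‖ ^ 2 := by
  simpa using memℓp_gen_iff (E := fun _ : ι => ℂ) (p := 2) (f := f) (by norm_num)

theorem hasSum_norm_sq (x : Hil ι) : HasSum (fun i => ‖x i‖ ^ 2) (‖x‖ ^ 2) := by
  simpa using lp.hasSum_norm (E := fun _ : ι => ℂ) (p := 2) (by norm_num) x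

theorem summable_sq_of_abs_le {a C : ι → ℝ} (hC : Summable fun i => C i ^ 2)
    (h : ∀ i, |a i| ≤ C i) : Summable fun i => a i ^ 2 :=
  hC.of_norm_bounded fun i => by
    rw [norm_pow]
    exact pow_le_pow_left₀ (norm_nonneg _) (h i) 2

/-- The isometry `x ↦ (x (σ i))ᵢ` of `ℓ²(ι)`. -/
def permIsometry (σ : Equiv.Perm ι) : Hil ι →ₗᵢ[ℂ] Hil ι where
  toFun x := ⟨fun i => x (σ i),
    memℓp_two_iff.2 ((hasSum_norm_sq x).summable.comp_injective σ.injective)⟩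
  map_add' _ _ := rfl
  map_smul' _ _ := rfl
  norm_map' x := by
    have h := (σ.hasSum_iff (f := fun i => ‖x i‖ ^ 2)).2 (hasSum_norm_sq x)
    exact (sq_eq_sq₀ (norm_nonneg _) (norm_nonneg _)).1 ((hasSum_norm_sq _).unique h)

end SquareSummable

/-- `X` is the weighted permutation `(X x) i = a i * x (σ i)` of the coordinates of `ℓ²(ι)`;
diagonal operators are those with `σ = 1`. -/
def IsWeightedPerm {ι : Type} (a : ι → ℝ) (σ : Equiv.Perm ι) (X : Hil ι →L[ℂ] Hil ι) : Prop :=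
  ∀ (x : Hil ι) (i : ι), X x i = (a i : ℂ) * x (σ i)

namespace IsWeightedPerm

variable {ι : Type} {a b : ι → ℝ} {σ τ : Equiv.Perm ι} {X Y : Hil ι →L[ℂ] Hil ι}

theorem exists_of_abs_le (σ : Equiv.Perm ι) {M : ℝ} (hM : ∀ i, |a i| ≤ M) :
    ∃ X, IsWeightedPerm a σ X := by
  have hdiag : ∀ i, ‖(a i : ℂ) • ContinuousLinearMap.id ℂ ℂ‖ ≤ max M 0 := fun i => by
    rw [norm_smul, ContinuousLinearMap.norm_id, mul_one, Complex.norm_real]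
    exact (hM i).trans (le_max_left M 0)
  let D : Hil ι →L[ℂ] Hil ι := lp.mapCLM 2 _ (le_max_right M 0) hdiag
  exact ⟨D.comp (permIsometry σ).toContinuousLinearMap, fun x i => rfl⟩

theorem exists_of_summable (σ : Equiv.Perm ι) (ha : Summable fun i => a i ^ 2) :
    ∃ X, IsWeightedPerm a σ X :=
  exists_of_abs_le σ fun i => Real.abs_le_sqrt (ha.le_tsum i fun _ _ => sq_nonneg _)

theorem eq (hX : IsWeightedPerm a σ X) (hY : IsWeightedPerm a σ Y) : X = Y :=
  ContinuousLinearMap.ext fun x => lp.ext (funext fun i => by rw [hX, hY])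

theorem add (hX : IsWeightedPerm a σ X) (hY : IsWeightedPerm b σ Y) :
    IsWeightedPerm (a + b) σ (X + Y) := fun x i => by
  rw [_root_.add_apply, lp.coeFn_add, Pi.add_apply, hX, hY, Pi.add_apply,
    Complex.ofReal_add, add_mul]

theorem sub (hX : IsWeightedPerm a σ X) (hY : IsWeightedPerm b σ Y) :
    IsWeightedPerm (a - b) σ (X - Y) := fun x i => by
  rw [_root_.sub_apply, lp.coeFn_sub, Pi.sub_apply, hX, hY, Pi.sub_apply,
    Complex.ofReal_sub, sub_mul]

theorem smul (c : ℝ) (hX : IsWeightedPerm a σ X) :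
    IsWeightedPerm (c • a) σ ((c : ℂ) • X) := fun x i => by
  rw [_root_.smul_apply, lp.coeFn_smul, Pi.smul_apply, hX, Pi.smul_apply,
    smul_eq_mul, smul_eq_mul, Complex.ofReal_mul, mul_assoc]

theorem comp (hX : IsWeightedPerm a σ X) (hY : IsWeightedPerm b τ Y) :
    IsWeightedPerm (fun i => a i * b (σ i)) (τ * σ) (X.comp Y) := fun x i => by
  rw [ContinuousLinearMap.comp_apply, hX, hY, Complex.ofReal_mul, mul_assoc, Equiv.Perm.mul_apply]

theorem conjOp_eq (hX : IsWeightedPerm a σ X) : conjOp X = X :=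
  ContinuousLinearMap.ext fun x => lp.ext (funext fun i => by
    rw [conjOp_apply, lp.star_apply, hX, hX, lp.star_apply, star_mul', star_star,
      Complex.star_def, Complex.conj_ofReal])

protected theorem adjoint (hX : IsWeightedPerm a σ X) :
    IsWeightedPerm (a ∘ σ.symm) σ⁻¹ (ContinuousLinearMap.adjoint X) := by
  classical
  intro x i
  have hsingle : X (lp.single 2 i 1) = (a (σ.symm i) : ℂ) • lp.single 2 (σ.symm i) 1 := by
    refine lp.ext (funext fun j => ?_)
    rw [hX, lp.coeFn_smul, Pi.smul_apply, smul_eq_mul]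
    rcases eq_or_ne j (σ.symm i) with rfl | hj
    · simp
    · rw [lp.single_apply_ne _ _ _ hj,
        lp.single_apply_ne _ _ _ fun h => hj (σ.symm_apply_eq.2 h.symm).symm, mul_zero, mul_zero]
  have h := ContinuousLinearMap.adjoint_inner_right X (lp.single 2 i 1) x
  rw [hsingle, inner_smul_left, lp.inner_single_left, lp.inner_single_left] at h
  simpa using h

theorem adjoint_eq_self (hX : IsWeightedPerm a σ X) (hσ : σ * σ = 1) (ha : ∀ i, a (σ i) = a i) :
    ContinuousLinearMap.adjoint X = X := by
  have hsymm : σ⁻¹ = σ := inv_eq_of_mul_eq_one_left hσ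
  have h := hX.adjoint
  rw [hsymm, show σ.symm = σ from hsymm, show a ∘ σ = a from funext ha] at h
  exact h.eq hX

theorem transOp_eq_self (hX : IsWeightedPerm a σ X) (hσ : σ * σ = 1) (ha : ∀ i, a (σ i) = a i) :
    transOp X = X := by
  rw [QuadFlow.transOp, hX.adjoint_eq_self hσ ha, hX.conjOp_eq]

theorem hasSum_re_inner (hX : IsWeightedPerm a 1 X) (x : Hil ι) :
    HasSum (fun i => a i * ‖x i‖ ^ 2) (inner ℂ x (X x)).re := by
  refine (Complex.hasSum_re (lp.hasSum_inner x (X x))).congr_fun fun i => ?_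
  rw [hX, Equiv.Perm.one_apply, RCLike.inner_apply, mul_assoc, Complex.mul_conj,
    ← Complex.ofReal_mul, Complex.ofReal_re, Complex.normSq_eq_norm_sq]

theorem hasSum_norm_sq (hX : IsWeightedPerm a σ X) (x : Hil ι) :
    HasSum (fun i => a i ^ 2 * ‖x (σ i)‖ ^ 2) (‖X x‖ ^ 2) := by
  refine (QuadFlow.hasSum_norm_sq (X x)).congr_fun fun i => ?_
  rw [hX, norm_mul, mul_pow, Complex.norm_real, Real.norm_eq_abs, sq_abs]

variable [DecidableEq ι]

theorem norm_apply_single_sq (hX : IsWeightedPerm a σ X) (i : ι) :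
    ‖X (lp.single 2 i (1 : ℂ))‖ ^ 2 = a (σ.symm i) ^ 2 := by
  refine (hX.hasSum_norm_sq _).unique ?_
  convert hasSum_single (σ.symm i) fun j hj => ?_ using 1
  · simp
  · rw [lp.single_apply_ne _ _ _ fun h => hj (σ.symm_apply_eq.2 h.symm).symm]
    simp

theorem isHS (hX : IsWeightedPerm a σ X) (ha : Summable fun i => a i ^ 2) : IsHS X := by
  unfold IsHS
  simp only [hX.norm_apply_single_sq]
  exact ha.comp_injective σ.symm.injective

theorem hsNorm_eq (hX : IsWeightedPerm a σ X) : hsNorm X = Real.sqrt (∑' i, a i ^ 2) := by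
  unfold hsNorm
  simp only [hX.norm_apply_single_sq]
  rw [σ.symm.tsum_eq fun i => a i ^ 2]

theorem abs_le_hsNorm (hX : IsWeightedPerm a σ X) (ha : Summable fun i => a i ^ 2) (i : ι) :
    |a i| ≤ hsNorm X := by
  rw [hX.hsNorm_eq]
  exact Real.abs_le_sqrt (ha.le_tsum i fun j _ => sq_nonneg _)

end IsWeightedPerm

section HilbertSchmidtTopology

variable {ι : Type} [DecidableEq ι] {F : ℝ → (Hil ι →L[ℂ] Hil ι)} {L D : Hil ι →L[ℂ] Hil ι}
  {l : Filter ℝ} {t : ℝ}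

theorem norm_le_hsNorm {X : Hil ι →L[ℂ] Hil ι} (hX : IsHS X) : ‖X‖ ≤ hsNorm X := by
  refine X.opNorm_le_bound (Real.sqrt_nonneg _) fun x => ?_
  have hsum : HasSum (fun i => x i • X (lp.single 2 i (1 : ℂ))) (X x) := by
    refine ((lp.hasSum_single (p := 2) (by norm_num) x).mapL X).congr_fun fun i => ?_
    rw [← map_smul, ← lp.single_smul, smul_eq_mul, mul_one]
  refine le_of_tendsto hsum.norm (Eventually.of_forall fun s => ?_)
  calc ‖∑ i ∈ s, x i • X (lp.single 2 i (1 : ℂ))‖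
      ≤ ∑ i ∈ s, ‖X (lp.single 2 i (1 : ℂ))‖ * ‖x i‖ :=
        norm_sum_le_of_le _ fun i _ => by rw [norm_smul, mul_comm]
    _ ≤ Real.sqrt (∑ i ∈ s, ‖X (lp.single 2 i (1 : ℂ))‖ ^ 2) * Real.sqrt (∑ i ∈ s, ‖x i‖ ^ 2) :=
        Real.sum_mul_le_sqrt_mul_sqrt _ _ _
    _ ≤ hsNorm X * ‖x‖ := by
        gcongr
        · exact Real.sqrt_nonneg _
        · exact Real.sqrt_le_sqrt (hX.sum_le_tsum s fun i _ => sq_nonneg _)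
        · exact Real.sqrt_le_iff.2
            ⟨norm_nonneg _, sum_le_hasSum s (fun i _ => sq_nonneg _) (hasSum_norm_sq x)⟩

theorem HSTendsto.tendsto (h : HSTendsto F l L) : Tendsto F l (𝓝 L) := by
  rw [tendsto_iff_norm_sub_tendsto_zero]
  exact squeeze_zero' (Eventually.of_forall fun _ => norm_nonneg _)
    (h.1.mono fun _ hs => norm_le_hsNorm hs) h.2

theorem HasHSDeriv.hasDerivWithinAt (h : HasHSDeriv F D t) :
    HasDerivWithinAt F D (Set.Ici 0) t := by
  rw [hasDerivWithinAt_iff_tendsto_slope]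
  refine h.2.tendsto.congr fun s => ?_
  rw [slope_def_module, ← Complex.ofReal_inv, Complex.coe_smul]
  rfl

variable {σ : Equiv.Perm ι} {a : ℝ → ι → ℝ} {C : ι → ℝ}

theorem hsTendsto_of_dominated {a₀ : ι → ℝ} (hF : ∀ᶠ u in l, IsWeightedPerm (a u) σ (F u))
    (hL : IsWeightedPerm a₀ σ L) (hC : Summable fun i => C i ^ 2)
    (hdom : ∀ᶠ u in l, ∀ i, |a u i - a₀ i| ≤ C i)
    (hlim : ∀ i, Tendsto (a · i) l (𝓝 (a₀ i))) : HSTendsto F l L := by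
  constructor
  · filter_upwards [hF, hdom] with u hFu hu
    exact (hFu.sub hL).isHS (summable_sq_of_abs_le hC hu)
  · have hsq : ∀ᶠ u in l, ∀ i, ‖(a u - a₀) i ^ 2‖ ≤ C i ^ 2 := hdom.mono fun u hu i => by
      rw [norm_pow]
      exact pow_le_pow_left₀ (norm_nonneg _) (hu i) 2
    have hterm : ∀ i, Tendsto (fun u => (a u - a₀) i ^ 2) l (𝓝 0) := fun i => by
      simpa using ((hlim i).sub_const (a₀ i)).pow 2
    have htsum : Tendsto (fun u => ∑' i, (a u - a₀) i ^ 2) l (𝓝 0) := by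
      simpa using tendsto_tsum_of_dominated_convergence hC hterm hsq
    have hsqrt : Tendsto (fun u => Real.sqrt (∑' i, (a u - a₀) i ^ 2)) l (𝓝 0) := by
      simpa using htsum.sqrt
    exact hsqrt.congr' (hF.mono fun u hu => ((hu.sub hL).hsNorm_eq).symm)

variable {a' : ℝ → ι → ℝ}

theorem hasHSDeriv_of_dominated (ht : 0 ≤ t) (hF : ∀ u, 0 ≤ u → IsWeightedPerm (a u) σ (F u))
    (hD : IsWeightedPerm (a' t) σ D)
    (ha : ∀ u, 0 ≤ u → ∀ i, HasDerivWithinAt (a · i) (a' u i) (Set.Ici 0) u)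
    (hC : Summable fun i => C i ^ 2) (hdom : ∀ u, 0 ≤ u → ∀ i, |a' u i| ≤ C i) :
    HasHSDeriv F D t := by
  have hmvt : ∀ u, 0 ≤ u → ∀ i, |a u i - a t i| ≤ C i * |u - t| := fun u hu i =>
    (convex_Ici (0 : ℝ)).norm_image_sub_le_of_norm_hasDerivWithin_le (f := (a · i))
      (fun v hv => ha v hv i) (fun v hv => hdom v hv i) ht hu
  have hquot : ∀ u, u ∈ Set.Ici 0 \ {t} → ∀ i, |(u - t)⁻¹ * (a u i - a t i)| ≤ C i := by
    intro u hu i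
    rw [abs_mul, abs_inv, inv_mul_le_iff₀ (abs_pos.2 (sub_ne_zero.2 hu.2)), mul_comm]
    exact hmvt u hu.1 i
  have h2C : Summable fun i => (2 * C i) ^ 2 := by
    simpa only [mul_pow] using hC.mul_left (2 ^ 2)
  refine ⟨hD.isHS (summable_sq_of_abs_le hC (hdom t ht)),
    hsTendsto_of_dominated (a := fun u => (u - t)⁻¹ • (a u - a t)) ?_ hD h2C ?_ fun i => ?_⟩
  · filter_upwards [self_mem_nhdsWithin] with u hu
    rw [← Complex.ofReal_inv]
    exact ((hF u hu.1).sub (hF t ht)).smul _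
  · filter_upwards [self_mem_nhdsWithin] with u hu i
    rw [two_mul]
    exact (abs_sub _ _).trans (add_le_add (hquot u hu i) (hdom t ht i))
  · exact hasDerivWithinAt_iff_tendsto_slope.1 (ha t ht i)

end HilbertSchmidtTopology

section TotalOp

variable {ι : Type} {W B D : Hil ι →L[ℂ] Hil ι}

/-- A bounded operator as a partially defined operator with full domain, the form in which it
enters `CondA1`, `CondA3` and `IsFlow`. -/
abbrev totalOp (X : Hil ι →L[ℂ] Hil ι) : Hil ι →ₗ.[ℂ] Hil ι :=
  (X : Hil ι →ₗ[ℂ] Hil ι).toPMap ⊤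

theorem totalOp_injective : Function.Injective (totalOp (ι := ι)) := fun X Y h =>
  ContinuousLinearMap.ext fun x => by
    obtain ⟨_, hXY⟩ := LinearPMap.ext_iff.1 h
    exact @hXY x trivial trivial

theorem vadd_totalOp (X Y : Hil ι →L[ℂ] Hil ι) :
    (X : Hil ι →ₗ[ℂ] Hil ι) +ᵥ totalOp Y = totalOp (X + Y) :=
  LinearPMap.ext rfl fun _ _ _ => rfl

theorem adjoint_totalOp (X : Hil ι →L[ℂ] Hil ι) :
    (totalOp X).adjoint = totalOp (ContinuousLinearMap.adjoint X) :=
  X.toPMap_adjoint_eq_adjoint_toPMap_of_dense (p := ⊤) (by simp)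

theorem transPMap_totalOp (X : Hil ι →L[ℂ] Hil ι) :
    transPMap (totalOp X) = totalOp (transOp X) := by
  rw [transPMap, adjoint_totalOp]
  exact LinearPMap.ext (Submodule.comap_top _) fun _ _ _ => rfl

theorem diagOp_eq_totalOp {f : ι → ℝ} (hW : IsWeightedPerm f 1 W) : diagOp f = totalOp W := by
  have happly : ∀ x : Hil ι, (fun i => (f i : ℂ) * x i) = W x := fun x =>
    funext fun i => (hW x i).symm
  refine LinearPMap.ext (Submodule.ext fun x => ⟨fun _ => trivial, fun _ => ?_⟩)
    fun x _ _ => lp.ext (happly x)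
  change Memℓp (fun i => (f i : ℂ) * x i) 2
  rw [happly]
  exact lp.memℓp (W x)

theorem forall_totalOp_eq_iff :
    (∀ x : (transPMap (totalOp W)).domain, ∃ h : B x ∈ (totalOp W).domain,
      D x = -(2 : ℂ) • (totalOp W ⟨B x, h⟩ + B (transPMap (totalOp W) x))) ↔
    D = -(2 : ℂ) • (W.comp B + B.comp (transOp W)) := by
  rw [transPMap_totalOp]
  constructor
  · intro h
    exact ContinuousLinearMap.ext fun x => (h ⟨x, trivial⟩).2
  · rintro rfl x
    exact ⟨trivial, rfl⟩

end TotalOp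

section Uniqueness

theorem eqOn_Ici_of_hasDerivWithinAt_of_locallyLipschitz {E : Type*} [NormedAddCommGroup E]
    [NormedSpace ℝ E] {v : E → E} (hv : LocallyLipschitz v) {f g : ℝ → E} {a : ℝ}
    (hf : ∀ t, a ≤ t → HasDerivWithinAt f (v (f t)) (Set.Ici a) t)
    (hg : ∀ t, a ≤ t → HasDerivWithinAt g (v (g t)) (Set.Ici a) t) (ha : f a = g a) :
    Set.EqOn f g (Set.Ici a) := by
  intro t ht
  have hcont : ∀ {h : ℝ → E}, (∀ t, a ≤ t → HasDerivWithinAt h (v (h t)) (Set.Ici a) t) →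
      ContinuousOn h (Set.Icc a t) := fun hh s hs =>
    ((hh s hs.1).mono Set.Icc_subset_Ici_self).continuousWithinAt
  have hK : IsCompact (f '' Set.Icc a t ∪ g '' Set.Icc a t) :=
    (isCompact_Icc.image_of_continuousOn (hcont hf)).union
      (isCompact_Icc.image_of_continuousOn (hcont hg))
  obtain ⟨K, hlip⟩ := (hv.locallyLipschitzOn (s := _)).exists_lipschitzOnWith_of_compact hK
  exact ODE_solution_unique_of_mem_Icc_right (v := fun _ => v) (fun _ _ => hlip)
    (hcont hf) (fun s hs => (hf s hs.1).mono (Set.Ici_subset_Ici.2 hs.1))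
    (fun s hs => Or.inl (Set.mem_image_of_mem f (Set.Ico_subset_Icc_self hs)))
    (hcont hg) (fun s hs => (hg s hs.1).mono (Set.Ici_subset_Ici.2 hs.1))
    (fun s hs => Or.inr (Set.mem_image_of_mem g (Set.Ico_subset_Icc_self hs))) ha ⟨ht, le_rfl⟩

theorem hasDerivWithinAt_Ici_of_continuousOn {E : Type*} [NormedAddCommGroup E]
    [NormedSpace ℝ E] {f f' : ℝ → E} {a : ℝ} (hf : ContinuousOn f (Set.Ici a))
    (hd : ∀ t, a < t → HasDerivWithinAt f (f' t) (Set.Ici a) t)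
    (hf' : ContinuousOn f' (Set.Ici a)) {t : ℝ} (ht : a ≤ t) :
    HasDerivWithinAt f (f' t) (Set.Ici a) t := by
  have hderiv : ∀ s, a < s → HasDerivAt f (f' s) s := fun s hs =>
    (hd s hs).hasDerivAt (Ici_mem_nhds hs)
  rcases ht.eq_or_lt with rfl | ht
  · refine hasDerivWithinAt_Ici_of_tendsto_deriv (s := Set.Ioi a)
      (fun s hs => (hderiv s hs).differentiableAt.differentiableWithinAt)
      ((hf a Set.self_mem_Ici).mono Set.Ioi_subset_Ici_self) self_mem_nhdsWithin ?_
    exact ((hf' a Set.self_mem_Ici).mono Set.Ioi_subset_Ici_self).tendsto.congr'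
      (eventually_mem_nhdsWithin.mono fun s hs => (hderiv s hs).deriv.symm)
  · exact hd t ht

variable {ι : Type}

theorem isBoundedLinearMap_conjOp : IsBoundedLinearMap ℝ (conjOp (ι := ι)) := by
  refine IsLinearMap.with_bound ⟨fun X Y => ?_, fun c X => ?_⟩ 1 fun X => ?_
  · exact ContinuousLinearMap.ext fun x => star_add (X (star x)) (Y (star x))
  · exact ContinuousLinearMap.ext fun x => star_smul c (X (star x))
  · rw [one_mul]
    refine (conjOp X).opNorm_le_bound (norm_nonneg _) fun x => ?_
    rw [conjOp_apply, norm_star]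
    simpa only [norm_star] using X.le_opNorm (star x)

theorem isBoundedLinearMap_transOp : IsBoundedLinearMap ℝ (transOp (ι := ι)) :=
  isBoundedLinearMap_conjOp.comp <| IsLinearMap.with_bound
    ⟨map_add ContinuousLinearMap.adjoint, fun c X => by
      refine (map_smulₛₗ ContinuousLinearMap.adjoint (c : ℂ) X).trans ?_
      rw [Complex.conj_ofReal]
      rfl⟩
    1 fun X => by rw [one_mul, LinearIsometryEquiv.norm_map]

/-- The vector field whose integral curves `t ↦ (Ω_t, B_t)` are the flows with bounded `Ω_t`. -/
def flowField (P : (Hil ι →L[ℂ] Hil ι) × (Hil ι →L[ℂ] Hil ι)) :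
    (Hil ι →L[ℂ] Hil ι) × (Hil ι →L[ℂ] Hil ι) :=
  (-(16 : ℂ) • P.2.comp (conjOp P.2), -(2 : ℂ) • (P.1.comp P.2 + P.2.comp (transOp P.1)))

theorem contDiff_flowField : ContDiff ℝ 1 (flowField (ι := ι)) := by
  have hconj := (isBoundedLinearMap_conjOp (ι := ι)).contDiff (n := 1)
  have htrans := (isBoundedLinearMap_transOp (ι := ι)).contDiff (n := 1)
  exact ((contDiff_snd.mul (hconj.comp contDiff_snd)).const_smul _).prodMk
    (((contDiff_fst.mul contDiff_snd).add
      (contDiff_snd.mul (htrans.comp contDiff_fst))).const_smul _)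

variable [DecidableEq ι] {W₀ B₀ : Hil ι →L[ℂ] Hil ι} {Ω Ω' : ℝ → (Hil ι →ₗ.[ℂ] Hil ι)}
  {B B' : ℝ → (Hil ι →L[ℂ] Hil ι)}

theorem IsFlow.exists_integralCurve (h : IsFlow (totalOp W₀) B₀ Ω B) :
    ∃ W : ℝ → (Hil ι →L[ℂ] Hil ι), (∀ t, 0 ≤ t → Ω t = totalOp (W t)) ∧
      ∀ t, 0 ≤ t →
        HasDerivWithinAt (fun s => (W s, B s)) (flowField (W t, B t)) (Set.Ici 0) t := by
  obtain ⟨Δ, hΔ⟩ := h.omega_deriv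
  have hΩ : ∀ t, 0 ≤ t → Ω t = totalOp (Δ t + W₀) := fun t ht => by
    rw [(hΔ t ht).2.1, vadd_totalOp]
  have hW : ∀ t, 0 ≤ t → HasDerivWithinAt (fun s => Δ s + W₀)
      (flowField (Δ t + W₀, B t)).1 (Set.Ici 0) t := fun t ht =>
    (hΔ t ht).2.2.hasDerivWithinAt.add_const W₀
  have hB_cont : ContinuousOn B (Set.Ici 0) := fun t ht => (h.b_cont t ht).tendsto
  have hB : ∀ t, 0 < t → HasDerivWithinAt B (flowField (Δ t + W₀, B t)).2 (Set.Ici 0) t := by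
    intro t ht
    obtain ⟨D, hD, hDx⟩ := h.b_deriv t ht
    rw [hΩ t ht.le, forall_totalOp_eq_iff] at hDx
    exact hD.hasDerivWithinAt.congr_deriv hDx
  have hW_cont : ContinuousOn (fun s => Δ s + W₀) (Set.Ici 0) := fun t ht =>
    (hW t ht).continuousWithinAt
  have hfield_cont : ContinuousOn (fun s => (flowField (Δ s + W₀, B s)).2) (Set.Ici 0) :=
    (continuous_snd.comp contDiff_flowField.continuous).comp_continuousOn
      (hW_cont.prodMk hB_cont)
  exact ⟨fun t => Δ t + W₀, hΩ, fun t ht =>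
    (hW t ht).prodMk (hasDerivWithinAt_Ici_of_continuousOn hB_cont hB hfield_cont ht)⟩

theorem IsFlow.unique (h : IsFlow (totalOp W₀) B₀ Ω B) (h' : IsFlow (totalOp W₀) B₀ Ω' B')
    {t : ℝ} (ht : 0 ≤ t) : Ω' t = Ω t ∧ B' t = B t := by
  obtain ⟨W, hΩ, hcurve⟩ := h.exists_integralCurve
  obtain ⟨W', hΩ', hcurve'⟩ := h'.exists_integralCurve
  have hW0 : W' 0 = W 0 := totalOp_injective <| by
    rw [← hΩ 0 le_rfl, ← hΩ' 0 le_rfl, h.omega_zero, h'.omega_zero]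
  have hB0 : B' 0 = B 0 := h'.b_zero.trans h.b_zero.symm
  have hWB : (W' t, B' t) = (W t, B t) :=
    eqOn_Ici_of_hasDerivWithinAt_of_locallyLipschitz contDiff_flowField.locallyLipschitz
      hcurve' hcurve (Prod.ext hW0 hB0) ht
  obtain ⟨hWt, hBt⟩ := Prod.ext_iff.1 hWB
  exact ⟨by rw [hΩ t ht, hΩ' t ht, show W' t = W t from hWt], hBt⟩

end Uniqueness

theorem IsWeightedPerm.condA1 {ι : Type} {w : ι → ℝ} {W : Hil ι →L[ℂ] Hil ι}
    (hW : IsWeightedPerm w 1 W) (hw : ∀ i, 0 ≤ w i) : CondA1 (totalOp W) := by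
  refine ⟨?_, fun x => (hW.hasSum_re_inner x).nonneg fun i => mul_nonneg (hw i) (sq_nonneg _)⟩
  rw [LinearPMap.isSelfAdjoint_def, adjoint_totalOp,
    hW.adjoint_eq_self (one_mul 1) fun _ => rfl]

/-- A solution of the flow in coordinates: `Ω_t` is diagonal with entries `w t` and `B_t` is the
weighted permutation given by `b t` and an involution `σ` that preserves both families of weights.
The last two fields keep the flow in the Hilbert–Schmidt class, uniformly in time. -/
structure CoordinateFlow {ι : Type} (σ : Equiv.Perm ι) (w b : ℝ → ι → ℝ) : Prop where
  perm_sq : σ * σ = 1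
  w_perm : ∀ t, 0 ≤ t → ∀ i, w t (σ i) = w t i
  b_perm : ∀ t, 0 ≤ t → ∀ i, b t (σ i) = b t i
  w_nonneg : ∀ t, 0 ≤ t → ∀ i, 0 ≤ w t i
  w_deriv : ∀ t, 0 ≤ t → ∀ i, HasDerivWithinAt (w · i) (-16 * b t i ^ 2) (Set.Ici 0) t
  b_deriv : ∀ t, 0 ≤ t → ∀ i, HasDerivWithinAt (b · i) (-4 * (w t i * b t i)) (Set.Ici 0) t
  w_le : ∃ M, ∀ t, 0 ≤ t → ∀ i, w t i ≤ M
  b_le : ∃ C : ι → ℝ, (Summable fun i => C i ^ 2) ∧ ∀ t, 0 ≤ t → ∀ i, |b t i| ≤ C i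

namespace CoordinateFlow

variable {ι : Type} {σ : Equiv.Perm ι} {w b : ℝ → ι → ℝ} {t : ℝ}

theorem summable_b_sq (h : CoordinateFlow σ w b) (ht : 0 ≤ t) : Summable fun i => b t i ^ 2 :=
  let ⟨_, hC, hb⟩ := h.b_le
  summable_sq_of_abs_le hC (hb t ht)

theorem exists_w_deriv_le (h : CoordinateFlow σ w b) :
    ∃ C : ι → ℝ, (Summable fun i => C i ^ 2) ∧ ∀ t, 0 ≤ t → ∀ i, |-16 * b t i ^ 2| ≤ C i := by
  obtain ⟨C, hC, hb⟩ := h.b_le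
  obtain ⟨K, hK⟩ : ∃ K, ∀ i, |C i| ≤ K :=
    ⟨_, fun i => Real.abs_le_sqrt (hC.le_tsum i fun _ _ => sq_nonneg _)⟩
  refine ⟨fun i => 16 * (K * C i), ?_, fun t ht i => ?_⟩
  · simpa only [mul_pow] using (hC.mul_left (K ^ 2)).mul_left (16 ^ 2)
  · have hbC : |b t i| ≤ C i := hb t ht i
    have hbK : |b t i| ≤ K := hbC.trans ((le_abs_self _).trans (hK i))
    have hK0 : 0 ≤ K := (abs_nonneg _).trans hbK
    rw [abs_mul, abs_neg, Nat.abs_ofNat, abs_pow, sq]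
    change _ ≤ 16 * (K * C i)
    gcongr

theorem exists_b_deriv_le (h : CoordinateFlow σ w b) :
    ∃ C : ι → ℝ, (Summable fun i => C i ^ 2) ∧
      ∀ t, 0 ≤ t → ∀ i, |-4 * (w t i * b t i)| ≤ C i := by
  obtain ⟨M, hM⟩ := h.w_le
  obtain ⟨C, hC, hb⟩ := h.b_le
  refine ⟨fun i => 4 * (M * C i), ?_, fun t ht i => ?_⟩
  · simpa only [mul_pow] using (hC.mul_left (M ^ 2)).mul_left (4 ^ 2)
  · have hw : 0 ≤ w t i := h.w_nonneg t ht i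
    have hwM : w t i ≤ M := hM t ht i
    have hbC : |b t i| ≤ C i := hb t ht i
    have hM0 : 0 ≤ M := hw.trans hwM
    rw [abs_mul, abs_mul, abs_neg, Nat.abs_ofNat, abs_of_nonneg hw]
    change _ ≤ 4 * (M * C i)
    gcongr

theorem summable_w_sub_sq (h : CoordinateFlow σ w b) (ht : 0 ≤ t) :
    Summable fun i => (w t - w 0) i ^ 2 := by
  obtain ⟨C, hC, hdom⟩ := h.exists_w_deriv_le
  refine summable_sq_of_abs_le (C := fun i => C i * ‖t - 0‖) ?_ fun i => ?_
  · simpa only [mul_pow] using hC.mul_right (‖t - 0‖ ^ 2)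
  · exact (convex_Ici (0 : ℝ)).norm_image_sub_le_of_norm_hasDerivWithin_le
      (fun s hs => h.w_deriv s hs i) (fun s hs => hdom s hs i) Set.self_mem_Ici ht

variable [DecidableEq ι] {W B : ℝ → (Hil ι →L[ℂ] Hil ι)}

theorem hsTendsto_b (h : CoordinateFlow σ w b) (hB : ∀ t, 0 ≤ t → IsWeightedPerm (b t) σ (B t))
    (ht : 0 ≤ t) : HSTendsto B (𝓝[Set.Ici 0] t) (B t) := by
  obtain ⟨C, hC, hb⟩ := h.b_le
  refine hsTendsto_of_dominated (C := fun i => 2 * C i) (eventually_mem_nhdsWithin.mono hB)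
    (hB t ht) ?_ (eventually_mem_nhdsWithin.mono fun u hu i => ?_)
    fun i => (h.b_deriv t ht i).continuousWithinAt
  · simpa only [mul_pow] using hC.mul_left (2 ^ 2)
  · rw [two_mul]
    exact (abs_sub _ _).trans (add_le_add (hb u hu i) (hb t ht i))

theorem hasHSDeriv_w (h : CoordinateFlow σ w b) (hW : ∀ t, 0 ≤ t → IsWeightedPerm (w t) 1 (W t))
    (hB : ∀ t, 0 ≤ t → IsWeightedPerm (b t) σ (B t)) (ht : 0 ≤ t) :
    HasHSDeriv (fun t => W t - W 0) (-(16 : ℂ) • (B t).comp (conjOp (B t))) t := by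
  obtain ⟨C, hC, hdom⟩ := h.exists_w_deriv_le
  have hD : IsWeightedPerm (fun i => -16 * b t i ^ 2) 1
      (-(16 : ℂ) • (B t).comp (conjOp (B t))) := by
    rw [(hB t ht).conjOp_eq]
    have hBB := ((hB t ht).comp (hB t ht)).smul (-16)
    rw [h.perm_sq] at hBB
    convert hBB using 1
    · funext i
      rw [Pi.smul_apply, smul_eq_mul, h.b_perm t ht, sq]
    · norm_num
  exact hasHSDeriv_of_dominated (a' := fun u i => -16 * b u i ^ 2) ht
    (fun u hu => (hW u hu).sub (hW 0 le_rfl)) hD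
    (fun u hu i => (h.w_deriv u hu i).sub_const _) hC hdom

theorem hasHSDeriv_b (h : CoordinateFlow σ w b) (hW : ∀ t, 0 ≤ t → IsWeightedPerm (w t) 1 (W t))
    (hB : ∀ t, 0 ≤ t → IsWeightedPerm (b t) σ (B t)) (ht : 0 ≤ t) :
    HasHSDeriv B (-(2 : ℂ) • ((W t).comp (B t) + (B t).comp (transOp (W t)))) t := by
  obtain ⟨C, hC, hdom⟩ := h.exists_b_deriv_le
  have hD : IsWeightedPerm (fun i => -4 * (w t i * b t i)) σ
      (-(2 : ℂ) • ((W t).comp (B t) + (B t).comp (transOp (W t)))) := by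
    rw [(hW t ht).transOp_eq_self (one_mul 1) fun _ => rfl]
    have hWB := (hW t ht).comp (hB t ht)
    have hBW := (hB t ht).comp (hW t ht)
    rw [mul_one] at hWB
    rw [one_mul] at hBW
    convert (hWB.add hBW).smul (-2) using 1
    · funext i
      simp only [Pi.smul_apply, Pi.add_apply, Equiv.Perm.one_apply, h.w_perm t ht, smul_eq_mul]
      ring
    · norm_num
  exact hasHSDeriv_of_dominated (a' := fun u i => -4 * (w u i * b u i)) ht hB hD h.b_deriv hC hdom

theorem isFlow (h : CoordinateFlow σ w b) (hW : ∀ t, 0 ≤ t → IsWeightedPerm (w t) 1 (W t))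
    (hB : ∀ t, 0 ≤ t → IsWeightedPerm (b t) σ (B t)) :
    IsFlow (totalOp (W 0)) (B 0) (fun t => totalOp (W t)) B where
  omega_zero := rfl
  b_zero := rfl
  omega_pos t ht := (hW t ht).condA1 (h.w_nonneg t ht)
  b_hs t ht := (hB t ht).isHS (h.summable_b_sq ht)
  b_cont _ ht := h.hsTendsto_b hB ht
  omega_deriv := ⟨fun t => W t - W 0, fun t ht =>
    ⟨((hW t ht).sub (hW 0 le_rfl)).isHS (h.summable_w_sub_sq ht),
      by rw [vadd_totalOp, sub_add_cancel], h.hasHSDeriv_w hW hB ht⟩⟩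
  b_deriv _ ht := ⟨_, h.hasHSDeriv_b hW hB ht.le, forall_totalOp_eq_iff.2 rfl⟩

theorem exists_isFlow (h : CoordinateFlow σ w b) :
    ∃ W B : ℝ → (Hil ι →L[ℂ] Hil ι), IsWeightedPerm (w 0) 1 (W 0) ∧
      (∀ t, 0 ≤ t → IsWeightedPerm (b t) σ (B t)) ∧
      IsFlow (totalOp (W 0)) (B 0) (fun t => totalOp (W t)) B := by
  obtain ⟨M, hM⟩ := h.w_le
  have hW : ∀ t, ∃ X, 0 ≤ t → IsWeightedPerm (w t) 1 X := fun t => by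
    by_cases ht : 0 ≤ t
    · obtain ⟨X, hX⟩ := IsWeightedPerm.exists_of_abs_le 1 fun i =>
        (abs_of_nonneg (h.w_nonneg t ht i)).trans_le (hM t ht i)
      exact ⟨X, fun _ => hX⟩
    · exact ⟨0, fun ht' => absurd ht' ht⟩
  have hB : ∀ t, ∃ X, 0 ≤ t → IsWeightedPerm (b t) σ X := fun t => by
    by_cases ht : 0 ≤ t
    · obtain ⟨X, hX⟩ := IsWeightedPerm.exists_of_summable σ (h.summable_b_sq ht)
      exact ⟨X, fun _ => hX⟩
    · exact ⟨0, fun ht' => absurd ht' ht⟩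
  choose W hW using hW
  choose B hB using hB
  exact ⟨W, B, hW 0 le_rfl, hB, h.isFlow hW hB⟩

end CoordinateFlow

section InitialData

variable {ι : Type} {w b : ι → ℝ} {σ : Equiv.Perm ι} {W B : Hil ι →L[ℂ] Hil ι}

theorem IsWeightedPerm.injective (hW : IsWeightedPerm w σ W) (hw : ∀ i, w i ≠ 0) :
    Function.Injective W := fun x y h => lp.ext <| funext fun i => by
  have hi : W x (σ.symm i) = W y (σ.symm i) := by rw [h]
  rw [hW, hW, σ.apply_symm_apply] at hi
  exact mul_left_cancel₀ (Complex.ofReal_ne_zero.2 (hw _)) hi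

theorem IsWeightedPerm.exists_comp_eq (hW : IsWeightedPerm w 1 W) (hB : IsWeightedPerm b σ B)
    (hw : ∀ i, 0 < w i) (hbw : ∀ i, |b i| ≤ w i) :
    ∃ Y, IsWeightedPerm (b / w) σ Y ∧ W.comp Y = B := by
  obtain ⟨Y, hY⟩ := IsWeightedPerm.exists_of_abs_le (a := b / w) (M := 1) σ fun i => by
    rw [Pi.div_apply, abs_div, abs_of_pos (hw i)]
    exact div_le_one_of_le₀ (hbw i) (hw i).le
  refine ⟨Y, hY, IsWeightedPerm.eq (a := b) (σ := σ) ?_ hB⟩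
  have hWY := hW.comp hY
  rw [mul_one] at hWY
  convert hWY using 2 with i
  exact (mul_div_cancel₀ (b i) (hw i).ne').symm

theorem IsWeightedPerm.transPMap_totalOp_apply (hW : IsWeightedPerm w 1 W) {Y : Hil ι →L[ℂ] Hil ι}
    (hB : IsWeightedPerm b σ B) (hWY : W.comp Y = B) (x : Hil ι) :
    ∃ y : (transPMap (totalOp W)).domain,
      transPMap (totalOp W) y = conjOp B x ∧ (y : Hil ι) = Y x := by
  rw [transPMap_totalOp, hW.transOp_eq_self (one_mul 1) fun _ => rfl, hB.conjOp_eq, ← hWY]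
  exact ⟨⟨Y x, trivial⟩, rfl, rfl⟩

theorem abs_le_of_four_mul_sq_le {x y : ℝ} (hy : 0 ≤ y) (h : 4 * x ^ 2 ≤ y ^ 2) : |x| ≤ y :=
  abs_le_of_sq_le_sq (by nlinarith [sq_nonneg x]) hy

theorem IsWeightedPerm.condA3 (hW : IsWeightedPerm w 1 W) (hB : IsWeightedPerm b σ B)
    (hσ : σ * σ = 1) (hwσ : ∀ i, w (σ i) = w i) (hbσ : ∀ i, b (σ i) = b i) (hw : ∀ i, 0 < w i)
    (hbw : ∀ i, 4 * b i ^ 2 ≤ w i ^ 2) : CondA3 (totalOp W) B := by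
  obtain ⟨Y, hY, hWY⟩ := hW.exists_comp_eq hB hw fun i =>
    abs_le_of_four_mul_sq_le (hw i).le (hbw i)
  refine ⟨fun z => ⟨⟨Y z, trivial⟩, DFunLike.congr_fun hWY z, fun y hy => Subtype.ext <|
    hW.injective (fun i => (hw i).ne') (Eq.trans hy (DFunLike.congr_fun hWY z).symm)⟩,
    fun x => ?_⟩
  obtain ⟨y, hy, hyx⟩ := hW.transPMap_totalOp_apply hB hWY x
  refine ⟨y, hy, ?_⟩
  have hBY := hB.comp hY
  rw [hσ] at hBY
  rw [hyx]
  refine hasSum_le (fun i => ?_) ((hBY.hasSum_re_inner x).mul_left 4) (hW.hasSum_re_inner x)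
  have hquot : 4 * (b i * (b / w) (σ i)) ≤ w i := by
    rw [Pi.div_apply, hbσ, hwσ, mul_div_assoc', mul_div_assoc', div_le_iff₀ (hw i), ← sq, ← sq]
    exact hbw i
  rw [← mul_assoc]
  exact mul_le_mul_of_nonneg_right hquot (sq_nonneg _)

theorem IsWeightedPerm.strictIneq (hW : IsWeightedPerm w 1 W) (hB : IsWeightedPerm b σ B)
    (hw : ∀ i, 0 < w i) (hbw : ∀ i, 4 * b i ^ 2 < w i ^ 2) : StrictIneq (totalOp W) B := by
  intro x hx
  obtain ⟨Y, hY, hWY⟩ := hW.exists_comp_eq hB hw fun i =>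
    abs_le_of_four_mul_sq_le (hw i).le (hbw i).le
  obtain ⟨y, hy, hyx⟩ := hW.transPMap_totalOp_apply hB hWY x
  refine ⟨y, hy, ?_⟩
  have hquot : ∀ i, 4 * (b / w) i ^ 2 < 1 := fun i => by
    rw [Pi.div_apply, div_pow, mul_div_assoc', div_lt_one (pow_pos (hw i) 2)]
    exact hbw i
  obtain ⟨j, hj⟩ : ∃ j, x (σ j) ≠ 0 := by
    by_contra! h
    exact hx (lp.ext (funext fun i => by simpa using h (σ.symm i)))
  rw [hyx]
  refine hasSum_lt (f := fun i => 4 * ((b / w) i ^ 2 * ‖x (σ i)‖ ^ 2))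
    (g := fun i => ‖x (σ i)‖ ^ 2) (i := j) (fun i => ?_) ?_
    ((hY.hasSum_norm_sq x).mul_left 4)
    ((σ.hasSum_iff (f := fun i => ‖x i‖ ^ 2)).2 (QuadFlow.hasSum_norm_sq x))
  · nlinarith [hquot i, sq_nonneg ‖x (σ i)‖]
  · nlinarith [hquot j, pow_pos (norm_pos_iff.2 hj) 2]

variable [DecidableEq ι]

theorem IsWeightedPerm.condA2 (hB : IsWeightedPerm b σ B) (hσ : σ * σ = 1)
    (hbσ : ∀ i, b (σ i) = b i) (hb : Summable fun i => b i ^ 2) {j : ι} (hj : b j ≠ 0) :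
    CondA2 B := by
  refine ⟨hB.transOp_eq_self hσ hbσ, hB.isHS hb, ?_⟩
  rintro rfl
  have h := hB.norm_apply_single_sq (σ j)
  rw [σ.symm_apply_apply] at h
  exact hj (by simpa using h.symm)

theorem IsWeightedPerm.mulIsHS_diagOp (hB : IsWeightedPerm b σ B) {f : ι → ℝ}
    (hfb : Summable fun i => (f i * b i) ^ 2) : MulIsHS (diagOp f) B := by
  obtain ⟨C, hC⟩ := IsWeightedPerm.exists_of_summable σ hfb
  have hfB : ∀ x, (fun i => (f i : ℂ) * B x i) = C x := fun x => funext fun i => by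
    rw [hC, hB, Complex.ofReal_mul, mul_assoc]
  refine ⟨C, hC.isHS hfb, fun x => ⟨?_, lp.ext (hfB x)⟩⟩
  change Memℓp (fun i => (f i : ℂ) * B x i) 2
  rw [hfB]
  exact lp.memℓp (C x)

end InitialData

/-- The diagonal entry at time `t` of the mode of scale `l`: `ω(t) = l coth (4 l t + 1)`. -/
def modeW (l t : ℝ) : ℝ := l * Real.cosh (4 * l * t + 1) / Real.sinh (4 * l * t + 1)

/-- The off-diagonal entry at time `t` of the mode of scale `l`:
`b(t) = l / (2 sinh (4 l t + 1))`. -/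
def modeB (l t : ℝ) : ℝ := l / (2 * Real.sinh (4 * l * t + 1))

section Modes

variable {l t : ℝ}

theorem sinh_mode_pos (hl : 0 < l) (ht : 0 ≤ t) : 0 < Real.sinh (4 * l * t + 1) :=
  Real.sinh_pos_iff.2 (by positivity)

theorem modeW_pos (hl : 0 < l) (ht : 0 ≤ t) : 0 < modeW l t :=
  div_pos (mul_pos hl (Real.cosh_pos _)) (sinh_mode_pos hl ht)

theorem modeB_pos (hl : 0 < l) (ht : 0 ≤ t) : 0 < modeB l t :=
  div_pos hl (mul_pos two_pos (sinh_mode_pos hl ht))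

theorem modeW_sq (hl : 0 < l) (ht : 0 ≤ t) : modeW l t ^ 2 = 4 * modeB l t ^ 2 + l ^ 2 := by
  have := (sinh_mode_pos hl ht).ne'
  rw [modeW, modeB, div_pow, div_pow, mul_pow, mul_pow, Real.cosh_sq]
  field_simp
  ring

theorem four_mul_modeB_sq_lt (hl : 0 < l) (ht : 0 ≤ t) : 4 * modeB l t ^ 2 < modeW l t ^ 2 := by
  rw [modeW_sq hl ht]
  exact lt_add_of_pos_right _ (pow_pos hl 2)

theorem modeB_le (hl : 0 < l) (ht : 0 ≤ t) : modeB l t ≤ l := by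
  have hsinh : 4 * l * t + 1 ≤ Real.sinh (4 * l * t + 1) :=
    Real.self_le_sinh_iff.2 (by positivity)
  have hlt : 0 ≤ 4 * l * t := by positivity
  exact div_le_self hl.le (by linarith)

theorem modeW_le (hl : 0 < l) (ht : 0 ≤ t) : modeW l t ≤ 3 * l := by
  refine le_of_sq_le_sq ?_ (by positivity)
  have hb := pow_le_pow_left₀ (modeB_pos hl ht).le (modeB_le hl ht) 2
  rw [modeW_sq hl ht]
  nlinarith

theorem hasDerivAt_mode_arg : HasDerivAt (fun s => 4 * l * s + 1) (4 * l) t := by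
  simpa only [mul_one, id] using ((hasDerivAt_id t).const_mul (4 * l)).add_const 1

theorem hasDerivAt_modeW (hl : 0 < l) (ht : 0 ≤ t) :
    HasDerivAt (modeW l) (-16 * modeB l t ^ 2) t := by
  have hs := (sinh_mode_pos hl ht).ne'
  refine HasDerivAt.congr_deriv (f := modeW l)
    ((hasDerivAt_mode_arg.cosh.const_mul l).div hasDerivAt_mode_arg.sinh hs) ?_
  rw [modeB]
  generalize 4 * l * t + 1 = x at hs ⊢
  field_simp
  linear_combination -16 * Real.cosh_sq x

theorem hasDerivAt_modeB (hl : 0 < l) (ht : 0 ≤ t) :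
    HasDerivAt (modeB l) (-4 * (modeW l t * modeB l t)) t := by
  have hs := (sinh_mode_pos hl ht).ne'
  refine HasDerivAt.congr_deriv (f := modeB l)
    ((hasDerivAt_const t l).div (hasDerivAt_mode_arg.sinh.const_mul 2)
      (mul_ne_zero two_ne_zero hs)) ?_
  rw [modeW, modeB]
  field_simp
  ring

theorem div_le_modeB (ht : 0 < t) (h1 : 1 ≤ l * t) (h2 : l * t ≤ 2) :
    1 / (2 * Real.sinh 9) / t ≤ modeB l t := by
  have hl : 0 < l := pos_of_mul_pos_left (one_pos.trans_le h1) ht.le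
  have hinv : 1 / t ≤ l := (div_le_iff₀ ht).2 h1
  have hsinh : Real.sinh (4 * l * t + 1) ≤ Real.sinh 9 := Real.sinh_le_sinh.2 (by linarith)
  rw [div_right_comm]
  exact div_le_div₀ hl.le hinv (mul_pos two_pos (sinh_mode_pos hl ht.le))
    (mul_le_mul_of_nonneg_left hsinh zero_le_two)

theorem abs_modeW_rpow_mul_modeB_le (hl : 0 < l) (ht : 0 ≤ t) {ε : ℝ} (hε : 0 ≤ ε) :
    |modeW l t ^ (-1 + ε) * modeB l t| ≤ 3 ^ ε * l ^ ε := by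
  have hw := modeW_pos hl ht
  have hb : |modeB l t| ≤ modeW l t :=
    abs_le_of_four_mul_sq_le hw.le (four_mul_modeB_sq_lt hl ht).le
  calc |modeW l t ^ (-1 + ε) * modeB l t|
      = modeW l t ^ (-1 + ε) * |modeB l t| := by
        rw [abs_mul, abs_of_pos (Real.rpow_pos_of_pos hw _)]
    _ ≤ modeW l t ^ (-1 + ε) * modeW l t := by gcongr
    _ = modeW l t ^ ε := by rw [← Real.rpow_add_one hw.ne', neg_add_cancel_comm]
    _ ≤ (3 * l) ^ ε := Real.rpow_le_rpow hw.le (modeW_le hl ht) hε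
    _ = 3 ^ ε * l ^ ε := Real.mul_rpow (by norm_num) hl.le

theorem coordinateFlow_mode {ι : Type} {σ : Equiv.Perm ι} {l : ι → ℝ} (hσ : σ * σ = 1)
    (hlσ : ∀ i, l (σ i) = l i) (hl : ∀ i, 0 < l i) (hsum : Summable fun i => l i ^ 2) :
    CoordinateFlow σ (fun t i => modeW (l i) t) (fun t i => modeB (l i) t) where
  perm_sq := hσ
  w_perm t _ i := by rw [hlσ]
  b_perm t _ i := by rw [hlσ]
  w_nonneg t ht i := (modeW_pos (hl i) ht).le
  w_deriv t ht i := (hasDerivAt_modeW (hl i) ht).hasDerivWithinAt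
  b_deriv t ht i := (hasDerivAt_modeB (hl i) ht).hasDerivWithinAt
  w_le := ⟨3 * Real.sqrt (∑' i, l i ^ 2), fun t ht i => (modeW_le (hl i) ht).trans <|
    mul_le_mul_of_nonneg_left
      (Real.le_sqrt_of_sq_le (hsum.le_tsum i fun _ _ => sq_nonneg _)) (by norm_num)⟩
  b_le := ⟨l, hsum, fun t ht i =>
    (abs_of_pos (modeB_pos (hl i) ht)).trans_le (modeB_le (hl i) ht)⟩

end Modes

theorem not_integrableOn_of_div_le {f : ℝ → ℝ} {c : ℝ} (hc : 0 < c)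
    (h : ∀ᶠ t : ℝ in atTop, c / t ≤ f t) (a : ℝ) :
    ¬ MeasureTheory.IntegrableOn f (Set.Ici a) MeasureTheory.volume := by
  intro hf
  have hinv : (fun t : ℝ => t⁻¹) =O[atTop] f := by
    refine Asymptotics.IsBigO.of_bound c⁻¹ ?_
    filter_upwards [h, eventually_gt_atTop 0] with t hct ht
    rw [Real.norm_of_nonneg (inv_pos.2 ht).le, ← div_eq_inv_mul, le_div_iff₀ hc, mul_comm,
      ← div_eq_mul_inv]
    exact hct.trans (le_abs_self _)
  have hinvInt : MeasureTheory.IntegrableAtFilter (fun t : ℝ => t⁻¹) atTop :=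
    hinv.integrableAtFilter measurable_inv.stronglyMeasurable.stronglyMeasurableAtFilter
      ⟨Set.Ici a, Ici_mem_atTop a, hf⟩
  simp only [← Real.rpow_neg_one, integrableAtFilter_rpow_atTop_iff, lt_irrefl] at hinvInt

/-- The scales `2⁻ᵏ` of the example, with the same one for both coordinates of the `k`-th block. -/
def dyadicScale (i : Ix) : ℝ := (1 / 2) ^ i.1

/-- The involution of the coordinates of `⨁ ℂ²` that exchanges the two coordinates of each block. -/
def blockSwap : Equiv.Perm Ix := (Equiv.refl ℕ).prodCongr Equiv.boolNot

/-- The numbers `ω_k` of the example, the initial values `ω(0)` of the modes of scale `2^(-|k|)`. -/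
def dyadicOmega (k : ℤ) : ℝ := modeW ((1 / 2) ^ k.natAbs) 0

/-- The numbers `b_k` of the example, the initial values `b(0)` of the modes of scale `2⁻ᵏ`. -/
def dyadicB (k : ℕ) : ℝ := modeB ((1 / 2) ^ k) 0

theorem isBlockB_iff {b : ℕ → ℝ} {B : Hil Ix →L[ℂ] Hil Ix} :
    IsBlockB b B ↔ IsWeightedPerm (fun i => b i.1) blockSwap B :=
  ⟨fun h x i => h x i.1 i.2, fun h x k s => h x (k, s)⟩

theorem blockSwap_mul_self : blockSwap * blockSwap = 1 :=
  Equiv.ext fun i => Prod.ext rfl (Bool.not_not i.2)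

theorem dyadicScale_pos (i : Ix) : 0 < dyadicScale i :=
  pow_pos one_half_pos i.1

theorem dyadicOmega_mode (i : Ix) : dyadicOmega (mode i) = modeW (dyadicScale i) 0 := by
  obtain ⟨k, _ | _⟩ := i <;> simp [dyadicOmega, dyadicScale, mode]

theorem dyadicOmega_pos (k : ℤ) : 0 < dyadicOmega k :=
  modeW_pos (pow_pos one_half_pos _) le_rfl

theorem four_mul_dyadicB_sq_lt (k : ℕ) :
    4 * dyadicB k ^ 2 < dyadicOmega k ^ 2 ∧ 4 * dyadicB k ^ 2 < dyadicOmega (-(k : ℤ)) ^ 2 := by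
  have h := four_mul_modeB_sq_lt (l := (1 / 2) ^ k) (pow_pos one_half_pos k) le_rfl
  rw [dyadicOmega, dyadicOmega, Int.natAbs_neg, Int.natAbs_natCast]
  exact ⟨h, h⟩

theorem summable_dyadicScale_rpow_sq {ε : ℝ} (hε : 0 < ε) :
    Summable fun i => (dyadicScale i ^ ε) ^ 2 := by
  have hq : ((1 / 2 : ℝ) ^ ε) ^ 2 < 1 :=
    pow_lt_one₀ (by positivity) (Real.rpow_lt_one (by norm_num) (by norm_num) hε) two_ne_zero
  have hpow : ∀ i, (dyadicScale i ^ ε) ^ 2 = (((1 / 2 : ℝ) ^ ε) ^ 2) ^ i.1 := fun i => by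
    rw [dyadicScale, ← Real.rpow_pow_comm (by norm_num), pow_right_comm]
  refine (summable_prod_of_nonneg fun i => by positivity).2 ⟨fun k => Summable.of_finite, ?_⟩
  simp only [hpow, tsum_fintype, Finset.sum_const]
  exact (summable_geometric_of_lt_one (by positivity) hq).const_smul _

theorem summable_dyadicScale_sq : Summable fun i => dyadicScale i ^ 2 := by
  simpa only [Real.rpow_one] using summable_dyadicScale_rpow_sq one_pos

theorem coordinateFlow_dyadic :
    CoordinateFlow blockSwap (fun t i => modeW (dyadicScale i) t)
      (fun t i => modeB (dyadicScale i) t) :=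
  coordinateFlow_mode blockSwap_mul_self (fun _ => rfl) dyadicScale_pos summable_dyadicScale_sq

variable {B : Hil Ix →L[ℂ] Hil Ix}

theorem mulIsHS_blockPow_dyadicOmega
    (hB : IsWeightedPerm (fun i => modeB (dyadicScale i) 0) blockSwap B) {ε : ℝ} (hε : 0 < ε) :
    MulIsHS (blockPow dyadicOmega (-1 + ε)) B := by
  refine hB.mulIsHS_diagOp (summable_sq_of_abs_le (C := fun i => 3 ^ ε * dyadicScale i ^ ε) ?_
    fun i => ?_)
  · simpa only [mul_pow] using (summable_dyadicScale_rpow_sq hε).mul_left ((3 ^ ε) ^ 2)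
  · rw [dyadicOmega_mode]
    exact abs_modeW_rpow_mul_modeB_le (dyadicScale_pos i) le_rfl hε.le

theorem div_le_hsNorm_dyadic {t : ℝ} (ht : 1 ≤ t)
    (hB : IsWeightedPerm (fun i => modeB (dyadicScale i) t) blockSwap B) :
    1 / (2 * Real.sinh 9) / t ≤ hsNorm B := by
  have ht0 : 0 < t := one_pos.trans_le ht
  obtain ⟨k, hk, hk'⟩ := exists_nat_pow_near ht one_lt_two
  have h2k : (0 : ℝ) < 2 ^ k := by positivity
  have hscale : dyadicScale (k, true) * t = t / 2 ^ k := by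
    rw [dyadicScale, one_div_pow, one_div_mul_eq_div]
  calc 1 / (2 * Real.sinh 9) / t ≤ modeB (dyadicScale (k, true)) t :=
        div_le_modeB ht0 (by rwa [hscale, one_le_div h2k])
          (by rw [hscale, div_le_iff₀ h2k, ← pow_succ']; exact hk'.le)
    _ ≤ |modeB (dyadicScale (k, true)) t| := le_abs_self _
    _ ≤ hsNorm B := hB.abs_le_hsNorm (coordinateFlow_dyadic.summable_b_sq ht0.le) (k, true)

end

end QuadFlow

theorem mainTheorem10 :
    ∃ (ω : ℤ → ℝ) (b : ℕ → ℝ) (B₀ : QuadFlow.Hil QuadFlow.Ix →L[ℂ] QuadFlow.Hil QuadFlow.Ix),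
      (∀ k, 0 < ω k) ∧
      QuadFlow.IsBlockB b B₀ ∧
      QuadFlow.CondA1 (QuadFlow.blockOmega ω) ∧
      QuadFlow.CondA2 B₀ ∧
      QuadFlow.CondA3 (QuadFlow.blockOmega ω) B₀ ∧
      QuadFlow.MulIsHS (QuadFlow.blockPow ω (-1 / 2)) B₀ ∧
      (∀ k : ℕ, 4 * b k ^ 2 < ω k ^ 2 ∧ 4 * b k ^ 2 < ω (-(k : ℤ)) ^ 2) ∧
      QuadFlow.StrictIneq (QuadFlow.blockOmega ω) B₀ ∧
      (∀ ε : ℝ, 0 < ε → QuadFlow.MulIsHS (QuadFlow.blockPow ω (-1 + ε)) B₀) ∧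
      ∃ (Ω : ℝ → (QuadFlow.Hil QuadFlow.Ix →ₗ.[ℂ] QuadFlow.Hil QuadFlow.Ix))
        (B : ℝ → (QuadFlow.Hil QuadFlow.Ix →L[ℂ] QuadFlow.Hil QuadFlow.Ix)),
        QuadFlow.IsFlow (QuadFlow.blockOmega ω) B₀ Ω B ∧
        (∀ Ω' B', QuadFlow.IsFlow (QuadFlow.blockOmega ω) B₀ Ω' B' →
          ∀ t, 0 ≤ t → Ω' t = Ω t ∧ B' t = B t) ∧
        (∃ c : ℝ, 0 < c ∧ ∀ᶠ t : ℝ in Filter.atTop, c / t ≤ QuadFlow.hsNorm (B t)) ∧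
        ¬ MeasureTheory.IntegrableOn (fun t : ℝ => QuadFlow.hsNorm (B t)) (Set.Ici 0)
          MeasureTheory.volume := by
  open QuadFlow in
  have hscale := coordinateFlow_dyadic
  obtain ⟨W, B, hW, hB, hflow⟩ := hscale.exists_isFlow
  have hB₀ := hB 0 le_rfl
  have hpow : ∀ ε : ℝ, 0 < ε → MulIsHS (blockPow dyadicOmega (-1 + ε)) (B 0) := fun ε hε =>
    mulIsHS_blockPow_dyadicOmega hB₀ hε
  have hw : ∀ i, 0 < modeW (dyadicScale i) 0 := fun i => modeW_pos (dyadicScale_pos i) le_rfl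
  have hbw := fun i => four_mul_modeB_sq_lt (dyadicScale_pos i) le_rfl
  have hc : 0 < 1 / (2 * Real.sinh 9) :=
    one_div_pos.2 (mul_pos two_pos (Real.sinh_pos_iff.2 (by norm_num)))
  have hdecay : ∀ᶠ t : ℝ in Filter.atTop, 1 / (2 * Real.sinh 9) / t ≤ hsNorm (B t) :=
    (Filter.eventually_ge_atTop 1).mono fun t ht =>
      div_le_hsNorm_dyadic ht (hB t (zero_le_one.trans ht))
  refine ⟨dyadicOmega, dyadicB, B 0, dyadicOmega_pos, isBlockB_iff.2 hB₀, ?_⟩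
  rw [show blockOmega dyadicOmega = totalOp (W 0) from
    (congrArg diagOp (funext dyadicOmega_mode)).trans (diagOp_eq_totalOp hW)]
  exact ⟨hW.condA1 fun i => (hw i).le,
    hB₀.condA2 blockSwap_mul_self (fun _ => rfl) (hscale.summable_b_sq le_rfl)
      (modeB_pos (dyadicScale_pos (0, true)) le_rfl).ne',
    hW.condA3 hB₀ blockSwap_mul_self (fun _ => rfl) (fun _ => rfl) hw fun i => (hbw i).le,
    by convert hpow (1 / 2) one_half_pos using 2; norm_num, four_mul_dyadicB_sq_lt,
    hW.strictIneq hB₀ hw hbw, hpow, _, B, hflow, fun _ _ h' t ht => hflow.unique h' ht,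
    ⟨_, hc, hdecay⟩, not_integrableOn_of_div_le hc hdecay 0⟩
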